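/- **Theorem (Upper bound, transmitter cooperation).** Let $K\ge 2$ and consider the $K$-user complex Gaussian interference channel $y_i(t)=\sum_{j=1}^K h_{ij}x_j(t)+z_i(t)$, $i=1,\dots,K$, $t=1,\dots,n$, with fixed gains $h_{ij}\in\mathbb{C}$ such that $h_{i+1,i}\neq 0$ for every $i$ (indices modulo $K$; in particular this holds if all gains are nonzero), and with noise $z_i(t)$ i.i.d. circularly-symmetric complex Gaussian with zero mean and unit variance, independent of the messages. The messages $W_1,\dots,W_K$ are independent, and $W_i$ is uniform on $\mathcal W_i=\{1,2,\dots,\lfloor 2^{nR_i}\rfloor\}$, where $R_i\ge0$. A length-$n$ scheme with interactive transmitter cooperation consists of - finite alphabets $\mathcal B^{[i,j]}$, $i\ne j$, and backhaul messages $m_{i\to j}(t)\in\mathcal B^{[i,j]}$, $t=1,\dots,n$, where $m_{i\to j}(t)$ is a function of $W_i$ and of all $m_{\ell\to i}(\tau)$ with $\ell\neq i$ and $\tau<t$; - encoders that produce $[x_i(t)]_{t=1}^n\in\mathbb C^n$ as a function of $W_i$ and of all $m_{\ell\to i}(\tau)$ with $\ell\ne i$ and $\tau\le n$, where every codeword satisfies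 $\frac1n\sum_{t=1}^n|x_i(t)|^2\le P$; - (measurable) decoders $\hat W_i=\eta_i([y_i(t)]_{t=1}^n)\in\mathcal W_i$. The rate tuple $(R_1,\dots,R_K)$ is achievable with power $P$ and average backhaul rate at most $L$ if for every $\epsilon>0$ and all sufficiently large $n$ there is such a scheme with $\mathbb P\big(\bigcup_i\{\hat W_i\ne W_i\}\big)<\epsilon$ and $$\frac1K\sum_{i=1}^K\sum_{j\ne i}\frac1n H\big([m_{i\to j}(\tau)]_{\tau=1}^n\big)\le L .$$ The capacity region $\mathcal C_L(P)$ is the closure of the set of achievable tuples. All logarithms and entropies are to base $2$. For $\alpha\in[0,\infty]$ let $\mathsf{DoF}^*(\alpha)$ be the supremum of $$\liminf_{P\to\infty}\frac{1}{K\log P}\sum_{k=1}^K R_k(P)$$ over all functions $L(P)$ with $\lim_{P\to\infty}L(P)/\log P=\alpha$ and all choices of rate tuples $(R_1(P),\dots,R_K(P))\in\mathcal C_{L(P)}(P)$ for all sufficiently large $P$. Then $$\mathsf{DoF}^*(\alpha)\le\min\Big\{1,\frac{1+\alpha}{2}\Big\}.$$ -/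

import Mathlib

open MeasureTheory ProbabilityTheory Filter Topology
open scoped NNReal ENNReal

namespace CoopIC

/-- The circularly-symmetric complex Gaussian law with zero mean and unit variance: real and
imaginary part are independent real Gaussians, each of variance `1 / 2`. -/
noncomputable def complexGaussian : Measure ℂ :=
  ((gaussianReal 0 (1 / 2)).prod (gaussianReal 0 (1 / 2))).map
    Complex.measurableEquivRealProd.symm

/-- The law of the noise `z i t`, independent over receivers `i` and times `t`. -/
noncomputable def noiseLaw (K n : ℕ) : Measure (Fin K → Fin n → ℂ) :=
  Measure.pi fun _ => Measure.pi fun _ => complexGaussian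

/-- The law of the messages: independent, `W i` uniform on a set of `M i` elements. -/
noncomputable def messageLaw {K : ℕ} (M : Fin K → ℕ) : Measure (∀ i, Fin (M i)) :=
  uniformOn Set.univ

/-- Shannon entropy, in bits, of a random variable with values in a finite set. -/
noncomputable def entropyBits {Ω β : Type*} [MeasurableSpace Ω] [Fintype β]
    (μ : Measure Ω) (X : Ω → β) : ℝ :=
  ∑ b, Real.negMulLog (μ.real (X ⁻¹' {b})) / Real.log 2

/-- A coding scheme of block length `n` for `K` users with interactive transmitter cooperation,
where user `i` has `M i` messages. -/
structure TxScheme (K n : ℕ) (M : Fin K → ℕ) where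
  /-- The size of the alphabet of the backhaul link from encoder `i` to encoder `j ≠ i`. -/
  alph : (i j : Fin K) → ℕ
  /-- The backhaul symbol that encoder `i` sends to encoder `j ≠ i` at time `t`, as a function of
  its own message and of all the backhaul symbols that it received at times before `t`. -/
  relay : (i : Fin K) → (j : {j : Fin K // j ≠ i}) → (t : Fin n) → Fin (M i) →
    ((l : {l : Fin K // l ≠ i}) → {τ : Fin n // τ < t} → Fin (alph l i)) → Fin (alph i j)
  /-- The codeword of encoder `i`, as a function of its own message and of all the backhaul
  symbols that it received. -/
  enc : (i : Fin K) → Fin (M i) →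
    ((l : {l : Fin K // l ≠ i}) → Fin n → Fin (alph l i)) → Fin n → ℂ
  /-- The decoder of receiver `i`, which only sees its own channel output. -/
  dec : (i : Fin K) → (Fin n → ℂ) → Fin (M i)
  measurable_dec : ∀ i, Measurable (dec i)

namespace TxScheme

variable {K n : ℕ} {M : Fin K → ℕ}

/-- The backhaul symbol sent from encoder `i` to encoder `j ≠ i` at time `t` when the messages
are `w`. -/
def msg (S : TxScheme K n M) (w : ∀ i, Fin (M i)) (t : Fin n) (i : Fin K)
    (j : {j : Fin K // j ≠ i}) : Fin (S.alph i j) :=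
  S.relay i j t (w i) fun l τ => S.msg w τ.1 l.1 ⟨i, l.2.symm⟩
termination_by t.val
decreasing_by exact τ.2

/-- The codeword sent by transmitter `i` when the messages are `w`. -/
def codeword (S : TxScheme K n M) (w : ∀ i, Fin (M i)) (i : Fin K) : Fin n → ℂ :=
  S.enc i (w i) fun l t => S.msg w t l.1 ⟨i, l.2.symm⟩

/-- The channel output `y i t = ∑ j, h i j * x j t + z i t` for messages `w` and noise `z`. -/
noncomputable def output (S : TxScheme K n M) (h : Fin K → Fin K → ℂ) (w : ∀ i, Fin (M i))
    (z : Fin K → Fin n → ℂ) (i : Fin K) : Fin n → ℂ :=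
  fun t => ∑ j, h i j * S.codeword w j t + z i t

/-- Every transmitted codeword has average power at most `P`. -/
def PowerConstraint (S : TxScheme K n M) (P : ℝ) : Prop :=
  ∀ (w : ∀ i, Fin (M i)) (i : Fin K), (1 / (n : ℝ)) * ∑ t, ‖S.codeword w i t‖ ^ 2 ≤ P

/-- The probability that at least one receiver decodes its message incorrectly. -/
noncomputable def errorProb (S : TxScheme K n M) (h : Fin K → Fin K → ℂ) : ℝ :=
  ((messageLaw M).prod (noiseLaw K n)).real
    {ω | ∃ i, S.dec i (S.output h ω.1 ω.2 i) ≠ ω.1 i}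

/-- The rate of the backhaul link from `i` to `j`: the joint entropy of all the symbols sent on
it, divided by the block length. -/
noncomputable def linkRate (S : TxScheme K n M) (i : Fin K) (j : {j : Fin K // j ≠ i}) : ℝ :=
  (1 / (n : ℝ)) * entropyBits (messageLaw M) fun w => fun t : Fin n => S.msg w t i j

/-- The average (per user) backhaul cooperation rate. -/
noncomputable def backhaulRate (S : TxScheme K n M) : ℝ :=
  (1 / (K : ℝ)) * ∑ i, ∑ j : {j : Fin K // j ≠ i}, S.linkRate i j

end TxScheme

/-- The rate tuple `R` (bits per channel use) is achievable with power `P` and average backhaul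
rate at most `L`. The message set `{1, …, 2 ^ (n R)}` has `⌊2 ^ (n R)⌋` elements. -/
def Achievable {K : ℕ} (h : Fin K → Fin K → ℂ) (P L : ℝ) (R : Fin K → ℝ) : Prop :=
  (∀ i, 0 ≤ R i) ∧ ∀ ε : ℝ, 0 < ε → ∃ N : ℕ, ∀ n : ℕ, N ≤ n →
    ∃ S : TxScheme K n (fun i => ⌊(2 : ℝ) ^ ((n : ℝ) * R i)⌋₊),
      S.PowerConstraint P ∧ S.errorProb h < ε ∧ S.backhaulRate ≤ L

/-- The capacity region with power `P` and average backhaul rate at most `L`. -/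
def capacityRegion {K : ℕ} (h : Fin K → Fin K → ℂ) (P L : ℝ) : Set (Fin K → ℝ) :=
  closure {R | Achievable h P L R}

/-- `d` is the average (per user) degrees of freedom of some choice of backhaul constraints
`L P` with `L P / log P → α` and of rate tuples `R P` in the corresponding capacity regions. -/
def IsDoF {K : ℕ} (h : Fin K → Fin K → ℂ) (α d : EReal) : Prop :=
  ∃ (L : ℝ → ℝ) (R : ℝ → Fin K → ℝ),
    Tendsto (fun P : ℝ => ((L P / Real.logb 2 P : ℝ) : EReal)) atTop (𝓝 α) ∧
    (∀ᶠ P in atTop, R P ∈ capacityRegion h P (L P)) ∧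
    d = liminf (fun P : ℝ => (((1 / (K * Real.logb 2 P)) * ∑ k, R P k : ℝ) : EReal)) atTop

/-- The average degrees of freedom per user at average per-user backhaul load `α`. -/
noncomputable def DoFStar {K : ℕ} (h : Fin K → Fin K → ℂ) (α : EReal) : EReal :=
  sSup {d | IsDoF h α d}

end CoopIC

/-!
The converse rests on a change of measure and on Jensen's inequality; neither differential
entropy nor Fano's inequality is used.

Fix a transmitter `i` and the receiver `k = i + 1`. If the messages other than `W i`, `W k` and all
backhaul symbols sent by transmitter `i` are fixed, then every codeword except that of
transmitter `i` is determined by `W k` (`TxScheme.codeword_congr`). As `h k i ≠ 0`, the noiseless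
output at receiver `i` is therefore `g` times the noiseless output at receiver `k` plus a shift
that depends on `W k` only, where `g = h i i / h k i` (`TxScheme.signal_sub_congr`). So receiver
`k`, once it knows `W k`, can imitate receiver `i` up to bounded noise.

To make this quantitative, the joint law of the two outputs is dominated by a constant `Cⁿ` times
the law of `(Y, g Y + shift + Z)`, where `Y` and `Z` are Gaussian, `Y` has a variance of the order
of `P` and `Z` has bounded variance. This law depends on `W k` only through the shift, the decoding
regions are disjoint, and so the probabilities of correct decoding add up to at most `Cⁿ` over all
`(W i, W k)` compatible with the given backhaul symbols (`sum_prob_decode_le`); here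
`log C = log P + O(1)`. Weighting each message tuple by the probability of the symbols sent by
transmitter `i` (the product of the marginal laws on its links) and summing over these symbols
gives `TxScheme.sum_pairProb_mul_le`. Jensen's inequality (`log_card_le_of_sum_mul_le`) turns the
weights into entropies, so that `n (R i + R k)` is at most `n log C` plus the entropies of the
links that leave `i`, up to `o(n)` and a factor tending to one.

Summing over `i` gives `2 ∑ R ≤ K (log P + L) + O(1)`. With `g = 0` and no second decoder the same
domination gives `∑ R ≤ K log P + O(1)`. Dividing by `K log P` and letting `P → ∞` yields the two
bounds.
-/

namespace CoopIC

/-! ### Gaussian densities and change of measure -/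

/-- A product of copies of a measure with a density is the product measure with the product
density. -/
theorem pi_withDensity_ofReal {ι E : Type*} [Fintype ι] [MeasurableSpace E] {μ : Measure E}
    [SigmaFinite μ] {f : E → ℝ} (hf : Integrable f μ) (h0 : ∀ x, 0 ≤ f x) :
    Measure.pi (fun _ : ι => μ.withDensity fun x => ENNReal.ofReal (f x)) =
      (Measure.pi fun _ : ι => μ).withDensity fun x => ENNReal.ofReal (∏ i, f (x i)) := by
  have : IsFiniteMeasure (μ.withDensity fun x => ENNReal.ofReal (f x)) :=
    isFiniteMeasure_withDensity_ofReal hf.2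
  refine Measure.pi_eq fun s hs => ?_
  have hind : ∀ i, Integrable ((s i).indicator f) μ := fun i => hf.indicator (hs i)
  have h0' : ∀ i x, 0 ≤ (s i).indicator f x := fun i x => Set.indicator_nonneg (fun x _ => h0 x) x
  rw [withDensity_apply _ (MeasurableSet.univ_pi hs),
    ← lintegral_indicator (MeasurableSet.univ_pi hs)]
  have h1 : ∀ x : ι → E, (Set.univ.pi s).indicator (fun x => ENNReal.ofReal (∏ i, f (x i))) x =
      ENNReal.ofReal (∏ i, (s i).indicator f (x i)) := by
    intro x
    by_cases hx : x ∈ Set.univ.pi s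
    · rw [Set.indicator_of_mem hx]
      congr 1
      exact Finset.prod_congr rfl fun i _ => by rw [Set.indicator_of_mem (hx i (Set.mem_univ i))]
    · rw [Set.indicator_of_notMem hx]
      simp only [Set.mem_pi, Set.mem_univ, true_imp_iff, not_forall] at hx
      obtain ⟨i, hi⟩ := hx
      rw [Finset.prod_eq_zero (Finset.mem_univ i) (Set.indicator_of_notMem hi f)]
      simp
  simp_rw [h1]
  rw [← ofReal_integral_eq_lintegral_ofReal (Integrable.fintype_prod_dep hind)
    (ae_of_all _ fun x => Finset.prod_nonneg fun i _ => h0' i _), integral_fintype_prod_eq_prod,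
    ENNReal.ofReal_prod_of_nonneg fun i _ => integral_nonneg (h0' i)]
  refine Finset.prod_congr rfl fun i _ => ?_
  rw [withDensity_apply _ (hs i), integral_indicator (hs i),
    ofReal_integral_eq_lintegral_ofReal hf.integrableOn (ae_of_all _ h0)]

/-- The density on `ℂ` of the circularly-symmetric complex Gaussian law of variance `v`. -/
noncomputable def gaussDensity (v : ℝ) (z : ℂ) : ℝ := (Real.pi * v)⁻¹ * Real.exp (-v⁻¹ * ‖z‖ ^ 2)

theorem gaussDensity_nonneg {v : ℝ} (hv : 0 < v) (z : ℂ) : 0 ≤ gaussDensity v z := by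
  unfold gaussDensity; positivity

theorem integral_gaussDensity {v : ℝ} (hv : 0 < v) : ∫ z, gaussDensity v z = 1 := by
  unfold gaussDensity
  rw [integral_const_mul, GaussianFourier.integral_rexp_neg_mul_sq_norm (inv_pos.2 hv)]
  simp [Complex.finrank_real_complex]
  field_simp

theorem integrable_gaussDensity {v : ℝ} (hv : 0 < v) : Integrable (gaussDensity v) :=
  integrable_of_integral_eq_one (integral_gaussDensity hv)

theorem complexGaussian_eq_withDensity :
    complexGaussian = volume.withDensity fun z => ENNReal.ofReal (gaussDensity 1 z) := by
  have hv : (1 / 2 : ℝ≥0) ≠ 0 := by norm_num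
  unfold complexGaussian
  rw [gaussianReal_of_var_ne_zero _ hv, prod_withDensity (measurable_gaussianPDF _ _)
    (measurable_gaussianPDF _ _)]
  ext s hs
  rw [MeasurableEquiv.map_apply,
    withDensity_apply _ (Complex.measurableEquivRealProd.symm.measurable hs),
    withDensity_apply _ hs,
    ← Complex.volume_preserving_equiv_real_prod.symm.setLIntegral_comp_preimage_emb
      Complex.measurableEquivRealProd.symm.measurableEmbedding]
  refine lintegral_congr fun p => ?_
  rw [gaussianPDF, gaussianPDF, ← ENNReal.ofReal_mul (gaussianPDFReal_nonneg _ _ _)]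
  congr 1
  have h2 : ‖Complex.measurableEquivRealProd.symm p‖ ^ 2 = p.1 ^ 2 + p.2 ^ 2 := by
    rw [← Complex.normSq_eq_norm_sq, Complex.normSq_apply]
    simp [Complex.measurableEquivRealProd]
    ring
  rw [gaussianPDFReal, gaussianPDFReal, gaussDensity, h2]
  have h3 : (2 * Real.pi * ((1 / 2 : ℝ≥0) : ℝ)) = Real.pi := by push_cast; ring
  rw [h3, mul_mul_mul_comm, ← Real.exp_add, ← mul_inv, Real.mul_self_sqrt Real.pi_pos.le]
  push_cast
  congr 2 <;> ring

instance : IsProbabilityMeasure complexGaussian := by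
  unfold complexGaussian
  exact Measure.isProbabilityMeasure_map (by fun_prop)

/-- The law of the noise at one receiver during a block of length `n`. -/
noncomputable abbrev noiseVec (n : ℕ) : Measure (Fin n → ℂ) :=
  Measure.pi fun _ => complexGaussian

/-- The density on `ℂⁿ` of `n` independent complex Gaussians of variance `v`. -/
noncomputable def gaussVecDensity (v : ℝ) {n : ℕ} (z : Fin n → ℂ) : ℝ≥0∞ :=
  ENNReal.ofReal (∏ t, gaussDensity v (z t))

theorem measurable_gaussVecDensity (v : ℝ) (n : ℕ) :
    Measurable (gaussVecDensity v : (Fin n → ℂ) → ℝ≥0∞) := by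
  unfold gaussVecDensity gaussDensity
  fun_prop

theorem lintegral_gaussVecDensity {v : ℝ} (hv : 0 < v) (n : ℕ) :
    ∫⁻ z : Fin n → ℂ, gaussVecDensity v z = 1 := by
  unfold gaussVecDensity
  rw [volume_pi, ← ofReal_integral_eq_lintegral_ofReal
    (Integrable.fintype_prod fun _ => integrable_gaussDensity hv)
    (ae_of_all _ fun z => Finset.prod_nonneg fun t _ => gaussDensity_nonneg hv _), ← volume_pi,
    integral_fintype_prod_volume_eq_pow, integral_gaussDensity hv]
  simp

theorem noiseVec_eq_withDensity (n : ℕ) :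
    noiseVec n = volume.withDensity (gaussVecDensity 1) := by
  rw [noiseVec, complexGaussian_eq_withDensity,
    pi_withDensity_ofReal (integrable_gaussDensity one_pos)
    (gaussDensity_nonneg one_pos)]
  rfl


/-- Pointwise domination of the density of the two outputs. Here `z` and `z'` are the noises, so
that `z' - g * z` is the second output minus `g` times the first, up to the shift. -/
theorem gaussDensity_mul_le {v s : ℝ} {g : ℂ} (hv : 4 ≤ v) (hs : 4 * (1 + ‖g‖ ^ 2) ≤ s)
    (a z z' : ℂ) :
    gaussDensity 1 z * gaussDensity 1 z' ≤
      v * s * Real.exp (2 * ‖a‖ ^ 2 / v) *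
        (gaussDensity v (a + z) * gaussDensity s (z' - g * z)) := by
  have hv0 : 0 < v := by linarith
  have hs4 : 4 ≤ s := by nlinarith [sq_nonneg ‖g‖]
  have hs0 : 0 < s := by linarith
  have h1 : ‖a + z‖ ^ 2 ≤ 2 * ‖a‖ ^ 2 + 2 * ‖z‖ ^ 2 := by
    have := norm_add_le a z
    nlinarith [sq_nonneg (‖a‖ - ‖z‖), norm_nonneg (a + z)]
  have h2 : ‖z' - g * z‖ ^ 2 ≤ 2 * ‖z'‖ ^ 2 + 2 * (‖g‖ ^ 2 * ‖z‖ ^ 2) := by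
    have := norm_sub_le z' (g * z)
    rw [norm_mul] at this
    nlinarith [sq_nonneg (‖z'‖ - ‖g‖ * ‖z‖), norm_nonneg (z' - g * z)]
  have e1 : v⁻¹ * ‖a + z‖ ^ 2 ≤ 2 * ‖a‖ ^ 2 / v + ‖z‖ ^ 2 / 2 := by
    have : ‖z‖ ^ 2 * 4 ≤ ‖z‖ ^ 2 * v := by gcongr
    rw [inv_mul_le_iff₀ hv0, mul_add, mul_div_cancel₀ _ hv0.ne']
    linarith
  have e2 : s⁻¹ * ‖z' - g * z‖ ^ 2 ≤ ‖z'‖ ^ 2 / 2 + ‖z‖ ^ 2 / 2 := by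
    have i1 : ‖z'‖ ^ 2 * 4 ≤ ‖z'‖ ^ 2 * s := by gcongr
    have i2 : ‖z‖ ^ 2 * (4 * (1 + ‖g‖ ^ 2)) ≤ ‖z‖ ^ 2 * s := by gcongr
    rw [inv_mul_le_iff₀ hs0]
    nlinarith [sq_nonneg ‖z‖]
  have e3 : Real.exp (-1⁻¹ * ‖z‖ ^ 2) * Real.exp (-1⁻¹ * ‖z'‖ ^ 2) ≤ Real.exp (2 * ‖a‖ ^ 2 / v) *
      (Real.exp (-v⁻¹ * ‖a + z‖ ^ 2) * Real.exp (-s⁻¹ * ‖z' - g * z‖ ^ 2)) := by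
    rw [← Real.exp_add, ← Real.exp_add, ← Real.exp_add]
    apply Real.exp_le_exp.2
    have := sq_nonneg ‖z'‖
    linarith
  unfold gaussDensity
  have hpi := Real.pi_pos
  calc _ = (Real.pi⁻¹ * Real.pi⁻¹) *
        (Real.exp (-1⁻¹ * ‖z‖ ^ 2) * Real.exp (-1⁻¹ * ‖z'‖ ^ 2)) := by rw [mul_one]; ring
    _ ≤ (Real.pi⁻¹ * Real.pi⁻¹) * (Real.exp (2 * ‖a‖ ^ 2 / v) *
      (Real.exp (-v⁻¹ * ‖a + z‖ ^ 2) * Real.exp (-s⁻¹ * ‖z' - g * z‖ ^ 2))) := by gcongr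
    _ = _ := by
      rw [mul_inv, mul_inv]
      field_simp

theorem gaussVecDensity_mul_le {v s : ℝ} {g : ℂ} (hv : 4 ≤ v) (hs : 4 * (1 + ‖g‖ ^ 2) ≤ s)
    {n : ℕ} {Q : ℝ} {a : Fin n → ℂ} (ha : ∑ t, ‖a t‖ ^ 2 ≤ n * Q) (z z' : Fin n → ℂ) :
    gaussVecDensity 1 z * gaussVecDensity 1 z' ≤
      ENNReal.ofReal ((v * s * Real.exp (2 * Q / v)) ^ n) *
        (gaussVecDensity v (a + z) * gaussVecDensity s (z' - g • z)) := by
  have hv0 : 0 < v := by linarith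
  have hs0 : 0 < s := by nlinarith [sq_nonneg ‖g‖]
  have p1 : ∀ z : Fin n → ℂ, 0 ≤ ∏ t, gaussDensity 1 (z t) :=
    fun z => Finset.prod_nonneg fun t _ => gaussDensity_nonneg one_pos _
  have p2 : ∀ z : Fin n → ℂ, 0 ≤ ∏ t, gaussDensity v (z t) :=
    fun z => Finset.prod_nonneg fun t _ => gaussDensity_nonneg hv0 _
  have p3 : ∀ z : Fin n → ℂ, 0 ≤ ∏ t, gaussDensity s (z t) :=
    fun z => Finset.prod_nonneg fun t _ => gaussDensity_nonneg hs0 _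
  unfold gaussVecDensity
  rw [← ENNReal.ofReal_mul (p1 _), ← ENNReal.ofReal_mul (p2 _),
    ← ENNReal.ofReal_mul (by positivity)]
  apply ENNReal.ofReal_le_ofReal
  rw [← Finset.prod_mul_distrib, ← Finset.prod_mul_distrib]
  calc ∏ t, gaussDensity 1 (z t) * gaussDensity 1 (z' t)
      ≤ ∏ t, (v * s * Real.exp (2 * ‖a t‖ ^ 2 / v) *
          (gaussDensity v ((a + z) t) * gaussDensity s ((z' - g • z) t))) :=
        Finset.prod_le_prod
          (fun t _ => mul_nonneg (gaussDensity_nonneg one_pos _) (gaussDensity_nonneg one_pos _))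
          fun t _ => gaussDensity_mul_le hv hs _ _ _
    _ = ((v * s) ^ n * Real.exp (2 * (∑ t, ‖a t‖ ^ 2) / v)) *
          ∏ t, (gaussDensity v ((a + z) t) * gaussDensity s ((z' - g • z) t)) := by
        rw [Finset.prod_mul_distrib, Finset.prod_mul_distrib, ← Real.exp_sum, Finset.mul_sum,
          Finset.sum_div]
        simp
    _ ≤ _ := by
        rw [mul_pow (v * s), ← Real.exp_nat_mul]
        have : 2 * (∑ t, ‖a t‖ ^ 2) / v ≤ n * (2 * Q / v) := by
          rw [mul_div_assoc', div_le_div_iff_of_pos_right hv0]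
          linarith
        have := Finset.prod_nonneg fun t (_ : t ∈ Finset.univ) =>
          mul_nonneg (gaussDensity_nonneg hv0 ((a + z) t))
            (gaussDensity_nonneg hs0 ((z' - g • z) t))
        gcongr

/-- The packing bound. Codeword pairs `x ∈ S` with labels `(u x, v x)` are sent over two Gaussian
channels with inputs `a x` and `b x`, and `b x` is `g • a x` up to a shift that depends on `v x`
only. The probabilities that both labels are decoded correctly then add up to at most `Cⁿ`, rather
than to the `C²ⁿ` that two unrelated inputs would allow. Each law is dominated by `Cⁿ` times that of
`(Y, g • Y + c (v x) + Z)`; on the event `D Y = v x` the shift is `c (D Y)`, so that the dominating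
law may be taken independent of `x`. -/
theorem sum_prob_decode_le {A U V : Type*} [MeasurableSpace U] [DiscreteMeasurableSpace U]
    [MeasurableSpace V] [DiscreteMeasurableSpace V] {n : ℕ} {S : Finset A} {u : A → U} {v : A → V}
    (hinj : ∀ x ∈ S, ∀ y ∈ S, u x = u y → v x = v y → x = y)
    {a b : A → Fin n → ℂ} {g : ℂ} {c : V → Fin n → ℂ} (hb : ∀ x ∈ S, b x = g • a x + c (v x))
    {D : (Fin n → ℂ) → V} {E : (Fin n → ℂ) → U} (hD : Measurable D) (hE : Measurable E)
    {Q r s : ℝ} (ha : ∀ x ∈ S, ∑ t, ‖a x t‖ ^ 2 ≤ n * Q) (hr : 4 ≤ r)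
    (hs : 4 * (1 + ‖g‖ ^ 2) ≤ s) :
    ∑ x ∈ S, ((noiseVec n).prod (noiseVec n)) {z | D (a x + z.1) = v x ∧ E (b x + z.2) = u x} ≤
      ENNReal.ofReal ((r * s * Real.exp (2 * Q / r)) ^ n) := by
  classical
  have hr0 : 0 < r := by linarith
  have hs0 : 0 < s := by nlinarith [sq_nonneg ‖g‖]
  set C := ENNReal.ofReal ((r * s * Real.exp (2 * Q / r)) ^ n)
  have hc : Measurable c := Measurable.of_discrete
  have hq := measurable_gaussVecDensity r n
  have hq' := measurable_gaussVecDensity s n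
  have h1 := measurable_gaussVecDensity 1 n
  let F : A → (Fin n → ℂ) × (Fin n → ℂ) → ℝ≥0∞ := fun x =>
    {y | D y.1 = v x ∧ E y.2 = u x}.indicator fun y =>
      C * (gaussVecDensity r y.1 * gaussVecDensity s (y.2 - (g • y.1 + c (D y.1))))
  have : (volume : Measure ((Fin n → ℂ) × (Fin n → ℂ))).IsAddLeftInvariant := by
    rw [Measure.volume_eq_prod]
    exact Measure.prod.instIsAddLeftInvariant
  have hset : ∀ x, MeasurableSet {y : (Fin n → ℂ) × (Fin n → ℂ) | D y.1 = v x ∧ E y.2 = u x} :=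
    fun x => ((hD.comp measurable_fst) (MeasurableSet.singleton (v x))).inter
      ((hE.comp measurable_snd) (MeasurableSet.singleton (u x)))
  have hFm : Measurable fun y : (Fin n → ℂ) × (Fin n → ℂ) =>
      C * (gaussVecDensity r y.1 * gaussVecDensity s (y.2 - (g • y.1 + c (D y.1)))) := by
    fun_prop
  have key : ∀ x ∈ S, ((noiseVec n).prod (noiseVec n))
      {z | D (a x + z.1) = v x ∧ E (b x + z.2) = u x} ≤ ∫⁻ y, F x y := by
    intro x hx
    have hset' : MeasurableSet {z : (Fin n → ℂ) × (Fin n → ℂ) |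
        D (a x + z.1) = v x ∧ E (b x + z.2) = u x} :=
      (show Measurable fun z : (Fin n → ℂ) × (Fin n → ℂ) => (a x + z.1, b x + z.2) by fun_prop)
        (hset x)
    rw [noiseVec_eq_withDensity, prod_withDensity h1 h1, withDensity_apply _ hset',
      ← lintegral_indicator hset', ← lintegral_add_left_eq_self (F x) (a x, b x)]
    refine lintegral_mono fun z => ?_
    by_cases hz : D (a x + z.1) = v x ∧ E (b x + z.2) = u x
    · rw [Set.indicator_of_mem (show z ∈ {z : (Fin n → ℂ) × (Fin n → ℂ) |
        D (a x + z.1) = v x ∧ E (b x + z.2) = u x} from hz)]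
      simp only [F]
      rw [Set.indicator_of_mem (show (a x, b x) + z ∈ {y : (Fin n → ℂ) × (Fin n → ℂ) |
        D y.1 = v x ∧ E y.2 = u x} from hz)]
      have : ((a x, b x) + z).2 - (g • ((a x, b x) + z).1 + c (D ((a x, b x) + z).1)) =
          z.2 - g • z.1 := by
        simp only [Prod.fst_add, Prod.snd_add]
        rw [hz.1, hb x hx, smul_add]
        abel
      rw [this]
      exact gaussVecDensity_mul_le hr hs (ha x hx) z.1 z.2
    · rw [Set.indicator_of_notMem (show z ∉ {z : (Fin n → ℂ) × (Fin n → ℂ) |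
        D (a x + z.1) = v x ∧ E (b x + z.2) = u x} from hz)]
      exact zero_le
  calc _ ≤ ∑ x ∈ S, ∫⁻ y, F x y := Finset.sum_le_sum key
    _ = ∫⁻ y, ∑ x ∈ S, F x y :=
      (lintegral_finsetSum _ fun x _ => hFm.indicator (hset x)).symm
    _ ≤ ∫⁻ y : (Fin n → ℂ) × (Fin n → ℂ),
        C * (gaussVecDensity r y.1 * gaussVecDensity s (y.2 - (g • y.1 + c (D y.1)))) := by
      refine lintegral_mono fun y => ?_
      by_cases hy : ∃ x ∈ S, D y.1 = v x ∧ E y.2 = u x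
      · obtain ⟨x, hx, hxy⟩ := hy
        rw [Finset.sum_eq_single_of_mem x hx]
        · exact Set.indicator_le_self _ _ _
        -- A pair of outputs is decoded to at most one element of `S`.
        · intro x' hx' hne
          refine Set.indicator_of_notMem (fun h' => hne ?_) _
          exact hinj _ hx' _ hx (h'.2.symm.trans hxy.2) (h'.1.symm.trans hxy.1)
      · rw [Finset.sum_eq_zero]
        · exact zero_le
        · intro x hx
          refine Set.indicator_of_notMem (fun h' => hy ⟨x, hx, ?_⟩) _
          exact h'
    _ = C := by
      rw [lintegral_const_mul _ (by fun_prop), Measure.volume_eq_prod,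
        lintegral_prod _ (by fun_prop)]
      simp only
      have : ∀ y : Fin n → ℂ, ∫⁻ y' : Fin n → ℂ, gaussVecDensity r y *
          gaussVecDensity s (y' - (g • y + c (D y))) = gaussVecDensity r y := by
        intro y
        rw [lintegral_const_mul _ (by fun_prop),
          lintegral_sub_right_eq_self (fun y' : Fin n → ℂ => gaussVecDensity s y'),
          lintegral_gaussVecDensity hs0, mul_one]
      simp_rw [this, lintegral_gaussVecDensity hr0, mul_one]

/-! ### Uniform messages and entropy -/

section Messages

variable {K : ℕ} {M : Fin K → ℕ}

theorem card_messages_pos (hM : ∀ i, 0 < M i) : 0 < Fintype.card (∀ i, Fin (M i)) := by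
  rw [Fintype.card_pi]
  exact Finset.prod_pos fun i _ => by simpa using hM i

theorem messageLaw_real (s : Set (∀ i, Fin (M i))) :
    (messageLaw M).real s = (s.ncard : ℝ) / Fintype.card (∀ i, Fin (M i)) := by
  rw [Measure.real, messageLaw, uniformOn_univ, ENNReal.toReal_div, Measure.count_apply]
  · rw [← s.toFinite.cast_ncard_eq, ENat.toENNReal_coe, ENNReal.toReal_natCast]
    simp
  · exact s.toFinite.measurableSet

theorem isProbabilityMeasure_messageLaw (hM : ∀ i, 0 < M i) :
    IsProbabilityMeasure (messageLaw M) := by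
  have : Nonempty (∀ i, Fin (M i)) := Fintype.card_pos_iff.1 (card_messages_pos hM)
  exact isProbabilityMeasure_uniformOn Set.finite_univ Set.univ_nonempty

theorem messageLaw_prod_real {Ω : Type*} [MeasurableSpace Ω] (ν : Measure Ω)
    [IsProbabilityMeasure ν] {s : Set ((∀ i, Fin (M i)) × Ω)} (hs : MeasurableSet s)
    (hM : ∀ i, 0 < M i) :
    ((messageLaw M).prod ν).real s =
      (∑ w, ν.real {z | (w, z) ∈ s}) / Fintype.card (∀ i, Fin (M i)) := by
  have := isProbabilityMeasure_messageLaw hM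
  rw [Measure.real, Measure.prod_apply hs, lintegral_fintype, ENNReal.toReal_sum
    (fun w _ => ENNReal.mul_ne_top (measure_ne_top _ _) (measure_ne_top _ _)), Finset.sum_div]
  refine Finset.sum_congr rfl fun w _ => ?_
  rw [ENNReal.toReal_mul, ← Measure.real, ← Measure.real, messageLaw_real]
  simp [div_eq_mul_inv, Set.preimage]

/-- The entropy of `X` is the average of minus the logarithm of the probability of its value. -/
theorem sum_neg_log_prob {β : Type*} [Fintype β] [DecidableEq β] (X : (∀ i, Fin (M i)) → β) :
    ∑ w, -Real.log ((messageLaw M).real (X ⁻¹' {X w})) =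
      Fintype.card (∀ i, Fin (M i)) * (entropyBits (messageLaw M) X * Real.log 2) := by
  have h2 : Real.log 2 ≠ 0 := (Real.log_pos one_lt_two).ne'
  rw [entropyBits, Finset.sum_mul, Finset.mul_sum,
    ← Finset.sum_fiberwise Finset.univ X (fun w => -Real.log ((messageLaw M).real (X ⁻¹' {X w})))]
  refine Finset.sum_congr rfl fun b _ => ?_
  have h1 : ∑ w with X w = b, -Real.log ((messageLaw M).real (X ⁻¹' {X w})) =
      ∑ w with X w = b, -Real.log ((messageLaw M).real (X ⁻¹' {b})) :=
    Finset.sum_congr rfl fun w hw => by rw [(Finset.mem_filter.1 hw).2]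
  have h3 : (((X ⁻¹' {b}).ncard : ℕ) : ℝ) = ((Finset.univ.filter fun w => X w = b).card : ℝ) := by
    rw [← Set.ncard_coe_finset]
    congr 2
    ext w
    simp
  rw [h1, Finset.sum_const, nsmul_eq_mul, ← h3, div_mul_cancel₀ _ h2, Real.negMulLog]
  rcases Nat.eq_zero_or_pos (Fintype.card (∀ i, Fin (M i))) with h0 | h0
  · have : IsEmpty (∀ i, Fin (M i)) := Fintype.card_eq_zero_iff.1 h0
    have : (X ⁻¹' {b}) = ∅ := Set.eq_empty_of_isEmpty _
    simp [this]
  · have h0' : (Fintype.card (∀ i, Fin (M i)) : ℝ) ≠ 0 := by exact_mod_cast h0.ne'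
    have : ((X ⁻¹' {b}).ncard : ℝ) =
        Fintype.card (∀ i, Fin (M i)) * (messageLaw M).real (X ⁻¹' {b}) := by
      rw [messageLaw_real, mul_div_cancel₀ _ h0']
    rw [this]
    ring

theorem sum_prob_fiber {β : Type*} [Fintype β] (X : (∀ i, Fin (M i)) → β) (hM : ∀ i, 0 < M i) :
    ∑ b, (messageLaw M).real (X ⁻¹' {b}) = 1 := by
  have := isProbabilityMeasure_messageLaw hM
  let _ : MeasurableSpace β := ⊤
  rw [sum_measureReal_preimage_singleton Finset.univ
    (fun b _ => (Set.toFinite (X ⁻¹' {b})).measurableSet)]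
  simp

theorem prob_fiber_pos {β : Type*} (X : (∀ i, Fin (M i)) → β) (w : ∀ i, Fin (M i)) :
    0 < (messageLaw M).real (X ⁻¹' {X w}) := by
  rw [messageLaw_real]
  have h1 : 0 < (X ⁻¹' {X w}).ncard := (Set.ncard_pos (Set.toFinite _)).2 ⟨w, rfl⟩
  have h2 : 0 < Fintype.card (∀ i, Fin (M i)) := Fintype.card_pos_iff.2 ⟨w⟩
  positivity

end Messages

/-- A substitute for Fano's inequality: if outcomes `w` succeed with probability `p w`, with average
at least `δ`, and the `p w` weighted by likelihoods `ρ w` sum to at most `B`, then the number of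
outcomes is bounded by `B` and by the average of `-log ρ`, which is an entropy in the application.
This is Jensen's inequality for `log` with weights proportional to `p`. -/
theorem log_card_le_of_sum_mul_le {W : Type*} [Fintype W] [Nonempty W] {p ρ : W → ℝ}
    (hp0 : ∀ w, 0 ≤ p w) (hp1 : ∀ w, p w ≤ 1) (hρ0 : ∀ w, 0 < ρ w) (hρ1 : ∀ w, ρ w ≤ 1)
    {B δ : ℝ} (hδ : 0 < δ) (hp : δ * Fintype.card W ≤ ∑ w, p w) (hB : ∑ w, p w * ρ w ≤ B) :
    Real.log (δ * Fintype.card W) ≤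
      Real.log B + (∑ w, -Real.log (ρ w)) / (δ * Fintype.card W) := by
  have hc : (0 : ℝ) < Fintype.card W := by exact_mod_cast Fintype.card_pos
  have hd : 0 < δ * Fintype.card W := by positivity
  set T := ∑ w, p w
  have hT : 0 < T := hd.trans_le hp
  have hsum : 0 < ∑ w, p w * ρ w := by
    obtain ⟨w, hw⟩ : ∃ w, p w ≠ 0 := by
      by_contra! hall
      exact hT.ne' (Finset.sum_eq_zero fun w _ => hall w)
    exact Finset.sum_pos' (fun w _ => mul_nonneg (hp0 w) (hρ0 w).le)
      ⟨w, Finset.mem_univ w, mul_pos ((hp0 w).lt_of_ne hw.symm) (hρ0 w)⟩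
  have hB0 : 0 < B := hsum.trans_le hB
  have hJ : ∑ w, (p w / T) • Real.log (ρ w) ≤ Real.log (∑ w, (p w / T) • ρ w) :=
    strictConcaveOn_log_Ioi.concaveOn.le_map_sum (fun w _ => div_nonneg (hp0 w) hT.le)
      (by rw [← Finset.sum_div, div_self hT.ne']) (fun w _ => hρ0 w)
  have e1 : ∑ w, (p w / T) • ρ w = (∑ w, p w * ρ w) / T := by
    rw [Finset.sum_div]
    exact Finset.sum_congr rfl fun w _ => by rw [smul_eq_mul]; ring
  have e2 : Real.log ((∑ w, p w * ρ w) / T) ≤ Real.log B - Real.log T := by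
    rw [Real.log_div hsum.ne' hT.ne']
    have := Real.log_le_log hsum hB
    linarith
  have e3 : -∑ w, (p w / T) • Real.log (ρ w) ≤ (∑ w, -Real.log (ρ w)) / (δ * Fintype.card W) := by
    rw [← Finset.sum_neg_distrib, Finset.sum_div]
    refine Finset.sum_le_sum fun w _ => ?_
    have hl : 0 ≤ -Real.log (ρ w) := neg_nonneg.2 (Real.log_nonpos (hρ0 w).le (hρ1 w))
    calc -((p w / T) • Real.log (ρ w)) = p w / T * -Real.log (ρ w) := by rw [smul_eq_mul]; ring
      _ ≤ 1 / (δ * Fintype.card W) * -Real.log (ρ w) := by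
        gcongr
        exact hp1 w
      _ = _ := by ring
  have e4 : Real.log (δ * Fintype.card W) ≤ Real.log T := Real.log_le_log hd hp
  rw [e1] at hJ
  linarith

/-! ### Signals and decoding probabilities of a scheme -/

namespace TxScheme

variable {K n : ℕ} {M : Fin K → ℕ}

/-- A change of the message of `i` influences the other encoders only through the backhaul symbols
that `i` sends. -/
theorem msg_congr (S : TxScheme K n M) {i : Fin K} {w w' : ∀ i, Fin (M i)}
    (hw : ∀ l, l ≠ i → w l = w' l) (hi : ∀ t j, S.msg w t i j = S.msg w' t i j) (t : Fin n)
    (l : Fin K) (j : {j : Fin K // j ≠ l}) : S.msg w t l j = S.msg w' t l j := by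
  by_cases hl : l = i
  · subst hl
    exact hi t j
  · rw [msg, msg, hw l hl]
    congr 1
    funext l' τ
    exact msg_congr S hw hi τ.1 l'.1 ⟨l, l'.2.symm⟩
termination_by t.val
decreasing_by exact τ.2

theorem codeword_congr (S : TxScheme K n M) {i : Fin K} {w w' : ∀ i, Fin (M i)}
    (hw : ∀ l, l ≠ i → w l = w' l) (hi : ∀ t j, S.msg w t i j = S.msg w' t i j)
    {l : Fin K} (hl : l ≠ i) : S.codeword w l = S.codeword w' l := by
  unfold codeword
  rw [hw l hl]
  congr 1
  funext l' t
  exact S.msg_congr hw hi t _ _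

/-- The noiseless channel output at receiver `i` when the messages are `w`. -/
noncomputable def signal (S : TxScheme K n M) (h : Fin K → Fin K → ℂ) (w : ∀ i, Fin (M i))
    (i : Fin K) : Fin n → ℂ :=
  fun t => ∑ j, h i j * S.codeword w j t

theorem output_eq (S : TxScheme K n M) (h : Fin K → Fin K → ℂ) (w : ∀ i, Fin (M i))
    (z : Fin K → Fin n → ℂ) (i : Fin K) : S.output h w z i = S.signal h w i + z i := rfl

/-- The combination of outputs that cancels the codeword of transmitter `i` depends only on the
other messages and on the backhaul symbols sent by `i`. -/
theorem signal_sub_congr (S : TxScheme K n M) (h : Fin K → Fin K → ℂ) {i k : Fin K}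
    (hki : h k i ≠ 0) {w w' : ∀ i, Fin (M i)} (hw : ∀ l, l ≠ i → w l = w' l)
    (hi : ∀ t j, S.msg w t i j = S.msg w' t i j) :
    S.signal h w i - (h i i / h k i) • S.signal h w k =
      S.signal h w' i - (h i i / h k i) • S.signal h w' k := by
  funext t
  have key : ∀ w : ∀ i, Fin (M i),
      (S.signal h w i - (h i i / h k i) • S.signal h w k) t =
        ∑ j ∈ Finset.univ.erase i, (h i j - h i i / h k i * h k j) * S.codeword w j t := by
    intro w
    simp only [Pi.sub_apply, Pi.smul_apply, smul_eq_mul, signal]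
    rw [Finset.mul_sum, ← Finset.sum_sub_distrib, ← Finset.add_sum_erase _ _ (Finset.mem_univ i)]
    have : h i i * S.codeword w i t - h i i / h k i * (h k i * S.codeword w i t) = 0 := by
      field_simp
      ring
    rw [this, zero_add]
    exact Finset.sum_congr rfl fun j _ => by ring
  rw [key, key]
  refine Finset.sum_congr rfl fun j hj => ?_
  rw [S.codeword_congr hw hi (Finset.ne_of_mem_erase hj)]

theorem sum_norm_signal_sq_le (S : TxScheme K n M) (h : Fin K → Fin K → ℂ) {P : ℝ} (hn : 0 < n)
    (hS : S.PowerConstraint P) (w : ∀ i, Fin (M i)) (k : Fin K) :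
    ∑ t, ‖S.signal h w k t‖ ^ 2 ≤ n * ((K * ∑ j, ‖h k j‖ ^ 2) * P) := by
  have hn' : (0 : ℝ) < n := by exact_mod_cast hn
  have h1 : ∀ t, ‖S.signal h w k t‖ ^ 2 ≤ (∑ j, ‖h k j‖ ^ 2) * ∑ j, ‖S.codeword w j t‖ ^ 2 := by
    intro t
    calc ‖S.signal h w k t‖ ^ 2 ≤ (∑ j, ‖h k j‖ * ‖S.codeword w j t‖) ^ 2 := by
          gcongr
          refine (norm_sum_le _ _).trans (Finset.sum_le_sum fun j _ => ?_)
          rw [norm_mul]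
      _ ≤ _ := Finset.sum_mul_sq_le_sq_mul_sq _ _ _
  have h2 : ∀ j, ∑ t, ‖S.codeword w j t‖ ^ 2 ≤ n * P := by
    intro j
    have := hS w j
    rwa [one_div, inv_mul_le_iff₀ hn'] at this
  calc ∑ t, ‖S.signal h w k t‖ ^ 2
      ≤ ∑ t, (∑ j, ‖h k j‖ ^ 2) * ∑ j, ‖S.codeword w j t‖ ^ 2 := Finset.sum_le_sum fun t _ => h1 t
    _ = (∑ j, ‖h k j‖ ^ 2) * ∑ j, ∑ t, ‖S.codeword w j t‖ ^ 2 := by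
        rw [← Finset.mul_sum, Finset.sum_comm]
    _ ≤ (∑ j, ‖h k j‖ ^ 2) * ∑ _j : Fin K, n * P := by
        have := fun j => h2 j
        gcongr with j
        exact h2 j
    _ = _ := by simp; ring

/-- The probability, given the messages `w`, that receivers `k` and `i` both decode correctly,
when the noises at these receivers are independent. -/
noncomputable def pairProb (S : TxScheme K n M) (h : Fin K → Fin K → ℂ) (k i : Fin K)
    (w : ∀ i, Fin (M i)) : ℝ :=
  ((noiseVec n).prod (noiseVec n)).real
    {z | S.dec k (S.signal h w k + z.1) = w k ∧ S.dec i (S.signal h w i + z.2) = w i}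

theorem map_noiseLaw_pair {k i : Fin K} (hki : k ≠ i) :
    (noiseLaw K n).map (fun z => (z k, z i)) = (noiseVec n).prod (noiseVec n) := by
  have hind := iIndepFun_pi (μ := fun _ : Fin K => noiseVec n)
    (X := fun _ z => z) (fun _ => aemeasurable_id)
  have h1 := (hind.indepFun hki)
  rw [indepFun_iff_map_prod_eq_prod_map_map (measurable_pi_apply k).aemeasurable
    (measurable_pi_apply i).aemeasurable] at h1
  have h2 : ∀ j : Fin K, (Measure.pi fun _ : Fin K => noiseVec n).map (fun z => z j) = noiseVec n :=
    fun j => (measurePreserving_eval (fun _ : Fin K => noiseVec n) j).map_eq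
  rw [h2, h2] at h1
  exact h1

instance : IsProbabilityMeasure (noiseLaw K n) := by
  unfold noiseLaw
  infer_instance

theorem measurableSet_decode (S : TxScheme K n M) (x : Fin n → ℂ) (i : Fin K) (m : Fin (M i)) :
    MeasurableSet {z : Fin n → ℂ | S.dec i (x + z) = m} :=
  (S.measurable_dec i).comp (measurable_const_add x) (MeasurableSet.singleton m)

theorem one_sub_le_pairProb (S : TxScheme K n M) (h : Fin K → Fin K → ℂ) {k i : Fin K}
    (hki : k ≠ i) (w : ∀ i, Fin (M i)) :
    1 - (noiseLaw K n).real {z | ∃ i, S.dec i (S.output h w z i) ≠ w i} ≤ S.pairProb h k i w := by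
  have hm : MeasurableSet {z : (Fin n → ℂ) × (Fin n → ℂ) |
      S.dec k (S.signal h w k + z.1) = w k ∧ S.dec i (S.signal h w i + z.2) = w i} :=
    (measurable_fst (S.measurableSet_decode _ k (w k))).inter
      (measurable_snd (S.measurableSet_decode _ i (w i)))
  have hm' : MeasurableSet {z : Fin K → Fin n → ℂ | ∃ i, S.dec i (S.output h w z i) ≠ w i} := by
    rw [Set.ofPred_exists]
    refine MeasurableSet.iUnion fun i => ?_
    have : Measurable fun z : Fin K → Fin n → ℂ => S.output h w z i := by
      simp only [output_eq]
      fun_prop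
    exact (((S.measurable_dec i).comp this) (MeasurableSet.singleton (w i))).compl
  rw [pairProb, ← map_noiseLaw_pair hki, map_measureReal_apply (by fun_prop) hm,
    ← probReal_compl_eq_one_sub hm']
  refine measureReal_mono fun z hz => ?_
  simp only [Set.mem_compl_iff, Set.mem_ofPred_eq, not_exists, not_not] at hz
  exact ⟨hz k, hz i⟩

theorem le_sum_pairProb (S : TxScheme K n M) (h : Fin K → Fin K → ℂ) (hM : ∀ i, 0 < M i)
    {k i : Fin K} (hki : k ≠ i) :
    (1 - S.errorProb h) * Fintype.card (∀ i, Fin (M i)) ≤ ∑ w, S.pairProb h k i w := by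
  have hm : MeasurableSet {ω : (∀ i, Fin (M i)) × (Fin K → Fin n → ℂ) |
      ∃ i, S.dec i (S.output h ω.1 ω.2 i) ≠ ω.1 i} := by
    rw [Set.ofPred_exists]
    refine MeasurableSet.iUnion fun i => ?_
    have : Measurable fun ω : (∀ i, Fin (M i)) × (Fin K → Fin n → ℂ) => S.output h ω.1 ω.2 i :=
      measurable_from_prod_countable_right fun w => by
        simp only [output_eq]
        fun_prop
    exact (measurableSet_eq_fun ((S.measurable_dec i).comp this) (by fun_prop)).compl
  have hc : (Fintype.card (∀ i, Fin (M i)) : ℝ) ≠ 0 := by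
    exact_mod_cast (card_messages_pos hM).ne'
  rw [errorProb, messageLaw_prod_real _ hm hM, sub_mul, div_mul_cancel₀ _ hc, one_mul]
  have := Finset.sum_le_sum fun w (_ : w ∈ Finset.univ) => S.one_sub_le_pairProb h hki w
  rw [Finset.sum_sub_distrib] at this
  simpa using this

end TxScheme

/-! ### Packing bounds for a coding scheme -/

section Card

variable {K : ℕ} (M : Fin K → ℕ)

theorem card_messages_eq_mul (k : Fin K) :
    Fintype.card (∀ i, Fin (M i)) =
      Fintype.card (∀ l : {l : Fin K // l ≠ k}, Fin (M l)) * M k := by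
  simp only [Fintype.card_pi, Fintype.card_fin]
  rw [← Finset.prod_erase_mul Finset.univ M (Finset.mem_univ k)]
  congr 1
  exact Finset.prod_subtype _ (by simp) M

theorem card_messages_eq_mul_mul {i k : Fin K} (hki : k ≠ i) :
    Fintype.card (∀ i, Fin (M i)) =
      Fintype.card (∀ l : {l : Fin K // l ≠ i ∧ l ≠ k}, Fin (M l)) * (M i * M k) := by
  simp only [Fintype.card_pi, Fintype.card_fin]
  rw [← Finset.prod_erase_mul Finset.univ M (Finset.mem_univ k),
    ← Finset.prod_erase_mul (Finset.univ.erase k) M (a := i) (by simp [hki.symm]), mul_assoc]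
  congr 1
  exact Finset.prod_subtype _ (by simp) M

end Card

/-- A bound on the factor, per channel use, in the domination behind the packing bound for
receiver `k`: the variance `4 + Q` of `Y`, where `Q` bounds the received signal power, times the
variance `4 * (1 + ‖g‖ ^ 2)` of `Z`, times a bound on `exp (2 * Q / (4 + Q))`. -/
noncomputable def gain {K : ℕ} (h : Fin K → Fin K → ℂ) (k : Fin K) (g : ℂ) (P : ℝ) : ℝ :=
  (4 + (K * ∑ j, ‖h k j‖ ^ 2) * P) * (4 * (1 + ‖g‖ ^ 2)) * Real.exp 2

theorem gain_pos {K : ℕ} (h : Fin K → Fin K → ℂ) (k : Fin K) (g : ℂ) {P : ℝ} (hP : 0 ≤ P) :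
    0 < gain h k g P := by
  unfold gain; positivity

theorem exists_log_gain_le {K : ℕ} (h : Fin K → Fin K → ℂ) (k : Fin K) (g : ℂ) :
    ∃ B : ℝ, ∀ P : ℝ, 1 ≤ P → Real.log (gain h k g P) ≤ Real.log P + B := by
  refine ⟨Real.log (gain h k g 1), fun P hP => ?_⟩
  rw [← Real.log_mul (by linarith) (gain_pos h k g zero_le_one).ne']
  refine Real.log_le_log (gain_pos h k g (by linarith)) ?_
  have h1 : 4 + (K * ∑ j, ‖h k j‖ ^ 2) * P ≤ P * (4 + (K * ∑ j, ‖h k j‖ ^ 2) * 1) := by linarith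
  calc gain h k g P ≤ P * (4 + (K * ∑ j, ‖h k j‖ ^ 2) * 1) * (4 * (1 + ‖g‖ ^ 2)) * Real.exp 2 := by
        unfold gain
        gcongr
    _ = P * gain h k g 1 := by
        unfold gain
        ring

namespace TxScheme

variable {K n : ℕ} {M : Fin K → ℕ}

/-- The packing bound `sum_prob_decode_le` for the channel output at receiver `k`, with the shift
given implicitly. -/
theorem sum_real_decode_le (S : TxScheme K n M) {h : Fin K → Fin K → ℂ} {P : ℝ} (hP : 0 ≤ P)
    (hn : 0 < n) (hS : S.PowerConstraint P) {k : Fin K} {U : Type*} [MeasurableSpace U]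
    [DiscreteMeasurableSpace U] {T : Finset (∀ i, Fin (M i))} {u : (∀ i, Fin (M i)) → U}
    (hinj : ∀ w ∈ T, ∀ w' ∈ T, u w = u w' → w k = w' k → w = w')
    {b : (∀ i, Fin (M i)) → Fin n → ℂ} {g : ℂ}
    (hb : ∀ w ∈ T, ∀ w' ∈ T, w k = w' k →
      b w - g • S.signal h w k = b w' - g • S.signal h w' k)
    {E : (Fin n → ℂ) → U} (hE : Measurable E) :
    ∑ w ∈ T, ((noiseVec n).prod (noiseVec n)).real
        {z | S.dec k (S.signal h w k + z.1) = w k ∧ E (b w + z.2) = u w} ≤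
      gain h k g P ^ n := by
  have hc : ∀ v : Fin (M k), ∃ c, ∀ w ∈ T, w k = v → b w - g • S.signal h w k = c := by
    intro v
    by_cases hv : ∃ w ∈ T, w k = v
    · obtain ⟨w, hw, hwv⟩ := hv
      exact ⟨_, fun w' hw' hwv' => hb w' hw' w hw (hwv'.trans hwv.symm)⟩
    · exact ⟨0, fun w hw hwv => (hv ⟨w, hw, hwv⟩).elim⟩
  choose c hc using hc
  set Q := (K * ∑ j, ‖h k j‖ ^ 2) * P with hQ
  have hQ0 : 0 ≤ Q := by positivity
  have key := sum_prob_decode_le (S := T) (u := u) (v := fun w => w k) hinj (g := g) (c := c)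
    (a := fun w => S.signal h w k) (b := b)
    (fun w hw => by rw [← hc (w k) w hw rfl]; abel) (S.measurable_dec k) hE
    (fun w _ => S.sum_norm_signal_sq_le h hn hS w k) (r := 4 + Q) (by linarith) le_rfl
  simp only [Measure.real]
  rw [← ENNReal.toReal_sum fun w _ => measure_ne_top _ _]
  refine (ENNReal.toReal_mono ENNReal.ofReal_ne_top key).trans ?_
  rw [ENNReal.toReal_ofReal (by positivity), gain, ← hQ]
  have : 2 * Q / (4 + Q) ≤ 2 := by
    rw [div_le_iff₀ (by linarith)]
    linarith
  gcongr

theorem pairProb_nonneg (S : TxScheme K n M) (h : Fin K → Fin K → ℂ) (k i : Fin K)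
    (w : ∀ i, Fin (M i)) : 0 ≤ S.pairProb h k i w := measureReal_nonneg

theorem pairProb_le_one (S : TxScheme K n M) (h : Fin K → Fin K → ℂ) (k i : Fin K)
    (w : ∀ i, Fin (M i)) : S.pairProb h k i w ≤ 1 := measureReal_le_one

theorem sum_pairProb_le (S : TxScheme K n M) {h : Fin K → Fin K → ℂ} {P : ℝ} (hP : 0 ≤ P)
    (hn : 0 < n) (hS : S.PowerConstraint P) (k i : Fin K) :
    ∑ w, S.pairProb h k i w ≤
      Fintype.card (∀ l : {l : Fin K // l ≠ k}, Fin (M l)) * gain h k 0 P ^ n := by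
  classical
  rw [← Finset.sum_fiberwise Finset.univ
    (fun (w : ∀ i, Fin (M i)) (l : {l : Fin K // l ≠ k}) => w l) (fun w => S.pairProb h k i w)]
  have := Finset.sum_le_card_nsmul (Finset.univ : Finset (∀ l : {l : Fin K // l ≠ k}, Fin (M l)))
    (fun r => ∑ w with (fun l : {l : Fin K // l ≠ k} => w l) = r, S.pairProb h k i w)
    (gain h k 0 P ^ n) ?_
  · simpa using this
  · intro r _
    refine (Finset.sum_le_sum fun w _ => ?_).trans (S.sum_real_decode_le hP hn hS
      (U := Unit) (u := fun _ => ()) (b := fun _ => 0) (g := 0) (E := fun _ => ()) ?_ ?_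
      measurable_const)
    · exact measureReal_mono fun z hz => ⟨hz.1, rfl⟩
    · intro w hw w' hw' _ hk
      funext l
      by_cases hl : l = k
      · subst hl
        exact hk
      · exact congrFun ((Finset.mem_filter.1 hw).2.trans (Finset.mem_filter.1 hw').2.symm) ⟨l, hl⟩
    · intros
      simp

/-- The single-user bound: whatever the cooperation, receiver `k` cannot decode more than about
`n log (gain)` nats. -/
theorem log_card_le (S : TxScheme K n M) {h : Fin K → Fin K → ℂ} {P : ℝ} (hP : 0 ≤ P)
    (hn : 0 < n) (hS : S.PowerConstraint P) (hM : ∀ i, 0 < M i) {k i : Fin K} (hki : k ≠ i)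
    {δ : ℝ} (hδ : 0 < δ) (herr : δ ≤ 1 - S.errorProb h) :
    Real.log (δ * M k) ≤ n * Real.log (gain h k 0 P) := by
  have hr : (0 : ℝ) < Fintype.card (∀ l : {l : Fin K // l ≠ k}, Fin (M l)) := by
    exact_mod_cast Nat.pos_of_mul_pos_right (card_messages_eq_mul M k ▸ card_messages_pos hM)
  have h1 := (S.le_sum_pairProb h hM hki).trans (S.sum_pairProb_le hP hn hS k i)
  rw [card_messages_eq_mul M k] at h1
  push_cast at h1
  rw [← Real.log_pow]
  have hMk : (0 : ℝ) < M k := by exact_mod_cast hM k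
  refine Real.log_le_log (by positivity) (le_of_mul_le_mul_left ?_ hr)
  refine le_trans ?_ h1
  have : δ * (Fintype.card (∀ l : {l : Fin K // l ≠ k}, Fin (M l)) * M k) ≤
    (1 - S.errorProb h) * (Fintype.card (∀ l : {l : Fin K // l ≠ k}, Fin (M l)) * M k) := by gcongr
  linarith

/-- All the backhaul symbols sent on the link from `i` to `j`. -/
def sent (S : TxScheme K n M) (i : Fin K) (j : {j : Fin K // j ≠ i}) (w : ∀ i, Fin (M i)) :
    Fin n → Fin (S.alph i j) :=
  fun t => S.msg w t i j

/-- The packing bound, summed over the messages of the other users and over the backhaul symbols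
sent by transmitter `i`. The weights are the products of the marginal probabilities on the links
that leave `i`; they sum to one over all symbols although the links may be dependent. -/
theorem sum_pairProb_mul_le (S : TxScheme K n M) {h : Fin K → Fin K → ℂ} {P : ℝ} (hP : 0 ≤ P)
    (hn : 0 < n) (hS : S.PowerConstraint P) (hM : ∀ i, 0 < M i) {k i : Fin K}
    (hc : h k i ≠ 0) :
    ∑ w, S.pairProb h k i w *
        ∏ j, (messageLaw M).real (S.sent i j ⁻¹' {S.sent i j w}) ≤
      Fintype.card (∀ l : {l : Fin K // l ≠ i ∧ l ≠ k}, Fin (M l)) *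
        gain h k (h i i / h k i) P ^ n := by
  classical
  let R := ∀ l : {l : Fin K // l ≠ i ∧ l ≠ k}, Fin (M l)
  let Y := ∀ j : {j : Fin K // j ≠ i}, Fin n → Fin (S.alph i j)
  let f : (∀ i, Fin (M i)) → R × Y := fun w => (fun l => w l, fun j => S.sent i j w)
  let ρ : Y → ℝ := fun y => ∏ j, (messageLaw M).real (S.sent i j ⁻¹' {y j})
  have hρ0 : ∀ y, 0 ≤ ρ y := fun y => Finset.prod_nonneg fun j _ => measureReal_nonneg
  -- The weights form a product probability mass function on the backhaul symbols sent by `i`.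
  have hρ1 : ∑ y, ρ y = 1 := by
    have : ∏ j, ∑ y, (messageLaw M).real (S.sent i j ⁻¹' {y}) = 1 :=
      Finset.prod_eq_one fun j _ => sum_prob_fiber (S.sent i j) hM
    rw [← this, Finset.prod_univ_sum, Fintype.piFinset_univ]
  rw [← Finset.sum_fiberwise Finset.univ f]
  calc _ ≤ ∑ x : R × Y, gain h k (h i i / h k i) P ^ n * ρ x.2 := by
        refine Finset.sum_le_sum fun x _ => ?_
        calc _ = (∑ w with f w = x, S.pairProb h k i w) * ρ x.2 := by
              rw [Finset.sum_mul]
              refine Finset.sum_congr rfl fun w hw => ?_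
              rw [← (Finset.mem_filter.1 hw).2]
          _ ≤ _ := by
              refine mul_le_mul_of_nonneg_right (S.sum_real_decode_le hP hn hS
                (u := fun w => w i) (b := fun w => S.signal h w i) ?_ ?_ (S.measurable_dec i))
                (hρ0 _)
              · intro w hw w' hw' hi hk
                have hf := (Finset.mem_filter.1 hw).2.trans (Finset.mem_filter.1 hw').2.symm
                funext l
                by_cases hl : l = k
                · subst hl
                  exact hk
                by_cases hl' : l = i
                · subst hl'
                  exact hi
                exact congrFun (congrArg Prod.fst hf) ⟨l, hl', hl⟩
              · intro w hw w' hw' hk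
                have hf := (Finset.mem_filter.1 hw).2.trans (Finset.mem_filter.1 hw').2.symm
                refine S.signal_sub_congr h hc (fun l hl' => ?_) fun t j => ?_
                · by_cases hl : l = k
                  · subst hl
                    exact hk
                  · exact congrFun (congrArg Prod.fst hf) ⟨l, hl', hl⟩
                · exact congrFun (congrFun (congrArg Prod.snd hf) j) t
    _ = _ := by
        rw [← Finset.mul_sum, Fintype.sum_prod_type]
        simp only [hρ1, Finset.sum_const, Finset.card_univ, nsmul_eq_mul, mul_one]
        rw [mul_comm]

/-- The two-user bound: the messages of `i` and `k` together carry at most one signal's worth of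
information plus the entropies of the links that leave transmitter `i`. -/
theorem log_card_mul_card_le (S : TxScheme K n M) {h : Fin K → Fin K → ℂ} {P : ℝ} (hP : 0 ≤ P)
    (hn : 0 < n) (hS : S.PowerConstraint P) (hM : ∀ i, 0 < M i) {k i : Fin K} (hki : k ≠ i)
    (hc : h k i ≠ 0) {δ : ℝ} (hδ : 0 < δ) (herr : δ ≤ 1 - S.errorProb h) :
    Real.log (δ * (M i * M k)) ≤ n * Real.log (gain h k (h i i / h k i) P) +
      n * Real.log 2 * (∑ j, S.linkRate i j) / δ := by
  have := isProbabilityMeasure_messageLaw hM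
  have hne : Nonempty (∀ i, Fin (M i)) := Fintype.card_pos_iff.1 (card_messages_pos hM)
  have hW : (0 : ℝ) < Fintype.card (∀ i, Fin (M i)) := by exact_mod_cast card_messages_pos hM
  have hn' : (n : ℝ) ≠ 0 := by exact_mod_cast hn.ne'
  have hr : (0 : ℝ) < Fintype.card (∀ l : {l : Fin K // l ≠ i ∧ l ≠ k}, Fin (M l)) := by
    exact_mod_cast Nat.pos_of_mul_pos_right
      (card_messages_eq_mul_mul M hki ▸ card_messages_pos hM)
  have hg := gain_pos h k (h i i / h k i) hP
  have hMi : (0 : ℝ) < M i := by exact_mod_cast hM i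
  have hMk : (0 : ℝ) < M k := by exact_mod_cast hM k
  have key := log_card_le_of_sum_mul_le (S.pairProb_nonneg h k i) (S.pairProb_le_one h k i)
    (fun w => Finset.prod_pos fun j _ => prob_fiber_pos (S.sent i j) w)
    (fun w => Finset.prod_le_one (fun _ _ => measureReal_nonneg) fun _ _ => measureReal_le_one)
    hδ (le_trans (by gcongr) (S.le_sum_pairProb h hM hki)) (S.sum_pairProb_mul_le hP hn hS hM hc)
  have e1 : ∑ w, -Real.log (∏ j, (messageLaw M).real (S.sent i j ⁻¹' {S.sent i j w})) =
      Fintype.card (∀ i, Fin (M i)) * (n * Real.log 2 * ∑ j, S.linkRate i j) := by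
    simp_rw [fun w => Real.log_prod (s := Finset.univ)
      (f := fun j => (messageLaw M).real (S.sent i j ⁻¹' {S.sent i j w}))
      (fun j _ => (prob_fiber_pos (S.sent i j) w).ne'), ← Finset.sum_neg_distrib]
    rw [Finset.sum_comm, Finset.mul_sum, Finset.mul_sum]
    refine Finset.sum_congr rfl fun j _ => ?_
    rw [sum_neg_log_prob, linkRate]
    change _ = _ * (n * Real.log 2 * (1 / n * entropyBits (messageLaw M) (S.sent i j)))
    field_simp
  rw [e1, mul_comm δ (Fintype.card _ : ℝ), mul_div_mul_left _ _ hW.ne',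
    Real.log_mul hr.ne' (by positivity), Real.log_pow, card_messages_eq_mul_mul M hki] at key
  push_cast at key
  rw [mul_assoc, mul_comm _ δ, Real.log_mul hr.ne' (by positivity)] at key
  linarith

end TxScheme

/-! ### From packing bounds to degrees of freedom -/

theorem finRotate_apply_ne {K : ℕ} (hK : 2 ≤ K) (i : Fin K) : finRotate K i ≠ i := by
  obtain ⟨m, rfl⟩ := Nat.exists_eq_add_of_le' hK
  rw [finRotate_apply]
  simp

theorem le_log_floor_two_rpow {n : ℕ} {R : ℝ} (hR : 0 ≤ R) :
    0 < ⌊(2 : ℝ) ^ ((n : ℝ) * R)⌋₊ ∧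
      n * R * Real.log 2 - Real.log 2 ≤ Real.log (⌊(2 : ℝ) ^ ((n : ℝ) * R)⌋₊ : ℝ) := by
  have h1 : (1 : ℝ) ≤ (2 : ℝ) ^ ((n : ℝ) * R) := Real.one_le_rpow one_le_two (by positivity)
  have h2 : 0 < ⌊(2 : ℝ) ^ ((n : ℝ) * R)⌋₊ := Nat.floor_pos.2 h1
  refine ⟨h2, ?_⟩
  have h3 : (1 : ℝ) ≤ (⌊(2 : ℝ) ^ ((n : ℝ) * R)⌋₊ : ℝ) := by exact_mod_cast h2
  have h4 := Nat.lt_floor_add_one ((2 : ℝ) ^ ((n : ℝ) * R))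
  have h5 : (2 : ℝ) ^ ((n : ℝ) * R) / 2 ≤ (⌊(2 : ℝ) ^ ((n : ℝ) * R)⌋₊ : ℝ) := by linarith
  have h6 := Real.log_le_log (by positivity) h5
  rwa [Real.log_div (by positivity) two_ne_zero, Real.log_rpow two_pos] at h6

theorem le_of_forall_le_add_div {a b c : ℝ} {N : ℕ} (h : ∀ n : ℕ, N ≤ n → 0 < n → a ≤ b + c / n) :
    a ≤ b := by
  have : Tendsto (fun n : ℕ => b + c / n) atTop (𝓝 (b + 0)) :=
    tendsto_const_nhds.add (tendsto_const_div_atTop_nhds_zero_nat c)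
  rw [add_zero] at this
  exact ge_of_tendsto this (by
    filter_upwards [eventually_ge_atTop N, eventually_gt_atTop 0] with n h1 h2 using h n h1 h2)

variable {K : ℕ} {h : Fin K → Fin K → ℂ}

/-- The sum rate is at most `K log P + O(1)`, with a constant that does not depend on the
backhaul. -/
theorem exists_sum_rate_le (hK : 2 ≤ K) :
    ∃ B : ℝ, ∀ P L : ℝ, 1 ≤ P → ∀ R ∈ capacityRegion h P L,
      ∑ k, R k ≤ K * Real.logb 2 P + B := by
  have hl2 : 0 < Real.log 2 := Real.log_pos one_lt_two
  choose B hB using fun k => exists_log_gain_le h k 0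
  refine ⟨(∑ k, B k) / Real.log 2, fun P L hP R hR => ?_⟩
  refine closure_minimal (t := {R | ∑ k, R k ≤ K * Real.logb 2 P + (∑ k, B k) / Real.log 2})
    (fun R hR => ?_) (isClosed_le (by fun_prop) (by fun_prop)) hR
  obtain ⟨hR0, hR⟩ := hR
  -- Any error probability bounded away from one is enough here.
  obtain ⟨N, hN⟩ := hR (1 / 2) (by norm_num)
  refine le_of_forall_le_add_div (c := (K * Real.log 2 - K * Real.log (1 / 2)) / Real.log 2)
    (N := N) fun n hn hn0 => ?_
  obtain ⟨S, hS, herr, -⟩ := hN n hn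
  have hn' : (0 : ℝ) < n := by exact_mod_cast hn0
  have hM := fun i => le_log_floor_two_rpow (n := n) (hR0 i)
  have key : ∀ k, Real.log (1 / 2) + n * R k * Real.log 2 - Real.log 2 ≤
      n * (Real.log P + B k) := by
    intro k
    have h1 := S.log_card_le (h := h) (by linarith) hn0 hS (fun i => (hM i).1) (k := k)
      (finRotate_apply_ne hK k).symm (δ := 1 / 2) (by norm_num) (by linarith)
    have h3 : (0 : ℝ) < (⌊(2 : ℝ) ^ ((n : ℝ) * R k)⌋₊ : ℝ) := by exact_mod_cast (hM k).1
    rw [Real.log_mul (by norm_num) h3.ne'] at h1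
    have h2 := mul_le_mul_of_nonneg_left (hB k P hP) hn'.le
    linarith [(hM k).2]
  have hsum := Finset.sum_le_sum fun k (_ : k ∈ Finset.univ) => key k
  rw [Finset.sum_sub_distrib, Finset.sum_add_distrib, ← Finset.sum_mul, ← Finset.mul_sum,
    ← Finset.mul_sum, Finset.sum_add_distrib] at hsum
  simp only [Finset.sum_const, Finset.card_univ, Fintype.card_fin, nsmul_eq_mul] at hsum
  rw [Real.logb]
  have : K * (Real.log P / Real.log 2) + (∑ k, B k) / Real.log 2 +
      (K * Real.log 2 - K * Real.log (1 / 2)) / Real.log 2 / n =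
      (n * (K * Real.log P + ∑ k, B k) + (K * Real.log 2 - K * Real.log (1 / 2))) /
        (n * Real.log 2) := by
    field_simp
  rw [this, le_div_iff₀ (by positivity)]
  linarith

/-- Twice the sum rate is at most `K (log P + L) + O(1)`: every rate occurs in two of the pairs
`(i, i + 1)`, and every backhaul link is counted once, at the transmitter it leaves. -/
theorem exists_two_mul_sum_rate_le (hK : 2 ≤ K) (hcross : ∀ i : Fin K, h (finRotate K i) i ≠ 0) :
    ∃ B : ℝ, ∀ P L : ℝ, 1 ≤ P → ∀ R ∈ capacityRegion h P L,
      2 * ∑ k, R k ≤ K * Real.logb 2 P + B + K * L := by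
  have hl2 : 0 < Real.log 2 := Real.log_pos one_lt_two
  have hK0 : (K : ℝ) ≠ 0 := by exact_mod_cast (by omega : K ≠ 0)
  choose B hB using fun i =>
    exists_log_gain_le h (finRotate K i) (h i i / h (finRotate K i) i)
  refine ⟨(∑ k, B k) / Real.log 2, fun P L hP R hR => ?_⟩
  refine closure_minimal
    (t := {R | 2 * ∑ k, R k ≤ K * Real.logb 2 P + (∑ k, B k) / Real.log 2 + K * L})
    (fun R hR => ?_) (isClosed_le (by fun_prop) (by fun_prop)) hR
  obtain ⟨hR0, hR⟩ := hR
  -- The success probability `δ` divides the backhaul term, so it has to tend to one after `n → ∞`.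
  have hδ : ∀ δ ∈ Set.Ioo (0 : ℝ) 1,
      2 * ∑ k, R k ≤ K * Real.logb 2 P + (∑ k, B k) / Real.log 2 + K * L / δ := by
    rintro δ ⟨hδ0, hδ1⟩
    obtain ⟨N, hN⟩ := hR (1 - δ) (by linarith)
    refine le_of_forall_le_add_div (c := (2 * K * Real.log 2 - K * Real.log δ) / Real.log 2)
      (N := N) fun n hn hn0 => ?_
    obtain ⟨S, hS, herr, hL⟩ := hN n hn
    have hn' : (0 : ℝ) < n := by exact_mod_cast hn0
    have hM := fun i => le_log_floor_two_rpow (n := n) (hR0 i)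
    have key : ∀ i, Real.log δ + (n * R i * Real.log 2 - Real.log 2) +
        (n * R (finRotate K i) * Real.log 2 - Real.log 2) ≤
        n * (Real.log P + B i) + n * Real.log 2 / δ * ∑ j, S.linkRate i j := by
      intro i
      have h1 := S.log_card_mul_card_le (by linarith) hn0 hS (fun i => (hM i).1)
        (finRotate_apply_ne hK i) (hcross i) hδ0 (by linarith)
      have h3 : ∀ k, (0 : ℝ) < (⌊(2 : ℝ) ^ ((n : ℝ) * R k)⌋₊ : ℝ) := fun k => by
        exact_mod_cast (hM k).1
      rw [Real.log_mul hδ0.ne' (mul_pos (h3 _) (h3 _)).ne', Real.log_mul (h3 _).ne' (h3 _).ne',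
        mul_div_right_comm] at h1
      have h2 := mul_le_mul_of_nonneg_left (hB i P hP) hn'.le
      linarith [(hM i).2, (hM (finRotate K i)).2]
    have hback : ∑ i, ∑ j, S.linkRate i j ≤ K * L := by
      have h1 : 1 / (K : ℝ) * ∑ i, ∑ j, S.linkRate i j ≤ L := hL
      rwa [one_div, inv_mul_le_iff₀ (by positivity)] at h1
    have hrot : ∑ i, R (finRotate K i) = ∑ i, R i := Equiv.sum_comp (finRotate K) R
    have hsum := Finset.sum_le_sum fun k (_ : k ∈ Finset.univ) => key k
    simp only [Finset.sum_sub_distrib, Finset.sum_add_distrib, ← Finset.sum_mul,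
      ← Finset.mul_sum, Finset.sum_const, Finset.card_univ, Fintype.card_fin, nsmul_eq_mul,
      hrot] at hsum
    have h4 : n * Real.log 2 / δ * ∑ i, ∑ j, S.linkRate i j ≤ n * Real.log 2 / δ * (K * L) := by
      gcongr
    rw [Real.logb]
    have : K * (Real.log P / Real.log 2) + (∑ k, B k) / Real.log 2 + K * L / δ +
        (2 * K * Real.log 2 - K * Real.log δ) / Real.log 2 / n =
        (n * (K * Real.log P + ∑ k, B k) + n * Real.log 2 / δ * (K * L) +
          (2 * K * Real.log 2 - K * Real.log δ)) / (n * Real.log 2) := by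
      field_simp
    rw [this, le_div_iff₀ (by positivity)]
    linarith
  have hlim : Tendsto (fun δ : ℝ => K * Real.logb 2 P + (∑ k, B k) / Real.log 2 + K * L / δ)
      (𝓝[<] 1) (𝓝 (K * Real.logb 2 P + (∑ k, B k) / Real.log 2 + K * L / 1)) :=
    (tendsto_const_nhds.add (tendsto_const_nhds.div tendsto_id one_ne_zero)).mono_left
      nhdsWithin_le_nhds
  rw [div_one] at hlim
  refine ge_of_tendsto hlim ?_
  filter_upwards [Ioo_mem_nhdsLT (zero_lt_one (α := ℝ))] with δ hδ' using hδ δ hδ'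

theorem liminf_coe_le_of_tendsto {u v : ℝ → ℝ} {a : ℝ} (huv : ∀ᶠ P in atTop, u P ≤ v P)
    (hv : Tendsto v atTop (𝓝 a)) : liminf (fun P => (u P : EReal)) atTop ≤ a :=
  (liminf_le_liminf (huv.mono fun P hP => EReal.coe_le_coe_iff.2 hP)).trans
    (EReal.tendsto_coe.2 hv).liminf_eq.le

theorem IsDoF.le_one (hK : 2 ≤ K) {α d : EReal} (hd : IsDoF h α d) : d ≤ 1 := by
  obtain ⟨L, R, -, hR, rfl⟩ := hd
  obtain ⟨B, hB⟩ := exists_sum_rate_le (h := h) hK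
  have hK0 : (0 : ℝ) < K := by exact_mod_cast (by omega : 0 < K)
  have hlog := Real.tendsto_logb_atTop one_lt_two
  refine liminf_coe_le_of_tendsto (v := fun P => 1 + B / K / Real.logb 2 P) ?_ ?_
  · filter_upwards [hR, eventually_gt_atTop 1] with P h1 h2
    have hl : 0 < Real.logb 2 P := Real.logb_pos one_lt_two h2
    have : 1 + B / K / Real.logb 2 P = 1 / (K * Real.logb 2 P) * (K * Real.logb 2 P + B) := by
      field_simp
    rw [this]
    gcongr
    exact hB P _ h2.le _ h1
  · simpa using tendsto_const_nhds.add (hlog.const_div_atTop (B / K))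

theorem IsDoF.le_half (hK : 2 ≤ K) (hcross : ∀ i : Fin K, h (finRotate K i) i ≠ 0) {a : ℝ}
    {d : EReal} (hd : IsDoF h a d) : d ≤ ((1 + a) / 2 : ℝ) := by
  obtain ⟨L, R, hL, hR, rfl⟩ := hd
  obtain ⟨B, hB⟩ := exists_two_mul_sum_rate_le hK hcross
  have hK0 : (0 : ℝ) < K := by exact_mod_cast (by omega : 0 < K)
  have hlog := Real.tendsto_logb_atTop one_lt_two
  refine liminf_coe_le_of_tendsto
    (v := fun P => (1 + B / K / Real.logb 2 P + L P / Real.logb 2 P) / 2) ?_ ?_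
  · filter_upwards [hR, eventually_gt_atTop 1] with P h1 h2
    have hl : 0 < Real.logb 2 P := Real.logb_pos one_lt_two h2
    have : (1 + B / K / Real.logb 2 P + L P / Real.logb 2 P) / 2 =
        1 / (K * Real.logb 2 P) * ((K * Real.logb 2 P + B + K * L P) / 2) := by
      field_simp
    rw [this]
    gcongr
    linarith [hB P _ h2.le _ h1]
  · simpa using ((tendsto_const_nhds.add (hlog.const_div_atTop (B / K))).add
      (EReal.tendsto_coe.1 hL)).div_const 2

end CoopIC

theorem theorem3 (K : ℕ) (hK : 2 ≤ K) (h : Fin K → Fin K → ℂ)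
    (hcross : ∀ i : Fin K, h (finRotate K i) i ≠ 0) (α : EReal) (hα : 0 ≤ α) :
    CoopIC.DoFStar h α ≤ min 1 ((1 + α) / 2) := by
  refine sSup_le fun d hd => le_min (CoopIC.IsDoF.le_one hK hd) ?_
  induction α with
  | bot => simp at hα
  | top =>
    rw [EReal.add_top_of_ne_bot (by decide), EReal.top_div_of_pos_ne_top (by norm_num) (by decide)]
    exact le_top
  | coe a => exact (CoopIC.IsDoF.le_half hK hcross hd).trans_eq rfl
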